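/- **Setting.** Let $n,m\ge 1$ and let $b_1,\dots,b_m$ be real functions that are positive and non-decreasing on $\{1,\dots,n\}$ and convex there in the discrete sense, i.e. $b_j(x+1)-b_j(x)$ is non-decreasing (more generally, for each $j$ it suffices that $x\mapsto b_j(x)x$ is convex in this sense). Let $\mathcal L=\{\sum_{j=1}^m\alpha_jb_j:\alpha_j\ge 0\}$ and let $\mathcal G$ be the class of congestion games with at most $n$ agents, a finite set of resources $\mathcal E$, resource costs $\ell_e\in\mathcal L$, and a nonempty set $\mathcal A_i\subseteq 2^{\mathcal E}$ of actions for each agent $i$. In an allocation $a=(a_i)_i$, $a_i\in\mathcal A_i$, let $|a|_e$ be the number of agents using $e$. The system cost is $\mathrm{SC}(a)=\sum_i\sum_{e\in a_i}\ell_e(|a|_e)$. A congestion-independent local toll is a map $T:\mathcal L\to\mathbb R_{\ge 0}$; under $T$ agent $i$ incurs the cost $\sum_{e\in a_i}[\ell_e(|a|_e)+T(\ell_e)]$. The price of anarchy $\mathrm{PoA}(T)\in[0,\infty]$ (for pure Nash, resp. coarse correlated, equilibria) is the supremum over $G\in\mathcal G$ of the highest (expected) system cost at an equilibrium of $G$ under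 $T$ divided by the minimum system cost of $G$ (with $0/0=0$ and $c/0=\infty$ for $c>0$). Consider the linear program of maximizing $\rho$ over $\rho\in\mathbb R$, $\nu\in[0,1]$ subject to, for all $j\in\{1,\dots,m\}$ and all $u,v\in\{0,\dots,n\}$ with $u\ge v$, $$b_j(v)v-\rho\, b_j(u)u+\nu[b_j(u)u-b_j(u+1)v]+b_j(1)(1-\nu)(u-v)\ge 0\quad\text{if }u+v\le n,$$ $$b_j(v)v-\rho\, b_j(u)u+\nu[b_j(u)(n-v)-b_j(u+1)(n-u)]+b_j(1)(1-\nu)(u-v)\ge 0\quad\text{if }u+v>n,$$ where $b_j(0)=b_j(n+1)=0$. **Theorem.** The program has an optimal solution $(\rho^*,\nu^*)$ with $\nu^*>0$, and every optimal solution has $\nu^*>0$ unless all $b_j$ are constant on $\{1,\dots,n\}$. For every optimal solution $(\rho^*,\nu^*)$ with $\nu^*>0$ one has $\rho^*>0$, and $$T^*\Big(\sum_{j=1}^m\alpha_jb_j\Big)=\sum_{j=1}^m\alpha_j\tau_j^*,\qquad \tau^*_j=\Big(\frac1{\nu^*}-1\Big)b_j(1)\ge 0,$$ is a well-defined, non-negative,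 congestion-independent local toll. It minimizes the price of anarchy over all (linear or non-linear) non-negative congestion-independent local tolls, and $\mathrm{PoA}(T^*)=1/\rho^*$. Both statements hold for pure Nash equilibria and for coarse correlated equilibria. -/

import Mathlib

/-- A congestion game with at most `n` agents whose resource costs belong to the class `L`.
The agents are `0, …, numAgents - 1`; every agent has a nonempty list of feasible sets of
resources. -/
structure CongestionGame (n : ℕ) (L : Set (ℕ → ℝ)) where
  numAgents : ℕ
  numAgents_le : numAgents ≤ n
  Resource : Type
  [fintypeResource : Fintype Resource]
  [decEqResource : DecidableEq Resource]
  cost : Resource → ℕ → ℝ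
  cost_mem : ∀ e, cost e ∈ L
  actions : Fin numAgents → Finset (Finset Resource)
  actions_nonempty : ∀ i, (actions i).Nonempty

attribute [instance] CongestionGame.fintypeResource CongestionGame.decEqResource

/-- A local tolling mechanism: the toll on a resource depends only on the cost function `ℓ` of
that resource, and `T ℓ x` is the toll levied when `x` agents use the resource. -/
abbrev LocalMechanism : Type := (ℕ → ℝ) → ℕ → ℝ

/-- The congestion-independent local mechanism that levies the constant toll `t ℓ` on every
resource with cost function `ℓ`. -/
def congestionIndependent (t : (ℕ → ℝ) → ℝ) : LocalMechanism := fun ℓ _ => t ℓ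

namespace CongestionGame

variable {n : ℕ} {L : Set (ℕ → ℝ)} (G : CongestionGame n L)

/-- Allocations: every agent chooses one of her feasible sets of resources. -/
abbrev Allocation : Type := (i : Fin G.numAgents) → {A : Finset G.Resource // A ∈ G.actions i}

/-- The number of agents using the resource `e`. -/
def load (a : G.Allocation) (e : G.Resource) : ℕ :=
  (Finset.univ.filter fun i => e ∈ (a i).1).card

/-- The system cost; tolls do not enter. -/
def systemCost (a : G.Allocation) : ℝ :=
  ∑ i, ∑ e ∈ (a i).1, G.cost e (G.load a e)

/-- The cost incurred by agent `i`: the costs and the tolls of all the resources she uses. -/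
def agentCost (T : LocalMechanism) (a : G.Allocation) (i : Fin G.numAgents) : ℝ :=
  ∑ e ∈ (a i).1, (G.cost e (G.load a e) + T (G.cost e) (G.load a e))

/-- Pure Nash equilibria of the tolled game. -/
def IsPureNash (T : LocalMechanism) (a : G.Allocation) : Prop :=
  ∀ (i : Fin G.numAgents) (A : {A : Finset G.Resource // A ∈ G.actions i}),
    G.agentCost T a i ≤ G.agentCost T (Function.update a i A) i

/-- Coarse correlated equilibria of the tolled game: probability distributions `p` over the
allocations such that no agent gains in expectation by committing to a fixed action. -/
def IsCoarseCorrelated (T : LocalMechanism) (p : G.Allocation → ℝ) : Prop :=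
  p ∈ stdSimplex ℝ G.Allocation ∧
    ∀ (i : Fin G.numAgents) (A : {A : Finset G.Resource // A ∈ G.actions i}),
      ∑ a, p a * G.agentCost T a i ≤ ∑ a, p a * G.agentCost T (Function.update a i A) i

/-- The minimum system cost. -/
noncomputable def minCost : ENNReal :=
  ⨅ a : G.Allocation, ENNReal.ofReal (G.systemCost a)

/-- The highest system cost at a pure Nash equilibrium. -/
noncomputable def nashCost (T : LocalMechanism) : ENNReal :=
  ⨆ (a : G.Allocation) (_ : G.IsPureNash T a), ENNReal.ofReal (G.systemCost a)

/-- The highest expected system cost at a coarse correlated equilibrium. -/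
noncomputable def coarseCost (T : LocalMechanism) : ENNReal :=
  ⨆ (p : G.Allocation → ℝ) (_ : G.IsCoarseCorrelated T p),
    ENNReal.ofReal (∑ a, p a * G.systemCost a)

end CongestionGame

/-- The price of anarchy of `T` for pure Nash equilibria, over all congestion games with at most
`n` agents and resource costs in `L`. In `[0, ∞]` one has `c / 0 = ∞` for `c > 0`, and
`0 / 0 = 0`, so that games in which all the costs involved vanish do not count. -/
noncomputable def pureNashPoA (n : ℕ) (L : Set (ℕ → ℝ)) (T : LocalMechanism) : ENNReal :=
  ⨆ G : CongestionGame n L, G.nashCost T / G.minCost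

/-- The price of anarchy of `T` for coarse correlated equilibria. -/
noncomputable def coarsePoA (n : ℕ) (L : Set (ℕ → ℝ)) (T : LocalMechanism) : ENNReal :=
  ⨆ G : CongestionGame n L, G.coarseCost T / G.minCost

/-- The resource costs `∑ j, α j * b j` with `α j ≥ 0`. -/
def costClass {m : ℕ} (b : Fin m → ℕ → ℝ) : Set (ℕ → ℝ) :=
  {ℓ | ∃ α : Fin m → ℝ, (∀ j, 0 ≤ α j) ∧ ℓ = fun x => ∑ j, α j * b j x}

/-- Convexity in the discrete sense on `{1, …, n}`: the increments are non-decreasing. -/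
def DiscreteConvex (n : ℕ) (f : ℕ → ℝ) : Prop :=
  ∀ x, 1 ≤ x → x + 2 ≤ n → f (x + 1) - f x ≤ f (x + 2) - f (x + 1)

/-- The restriction of `f` to `{1, …, n}`, with the convention that it vanishes at all other
points (only `0` and `n + 1` are ever used). -/
def zeroExtend (n : ℕ) (f : ℕ → ℝ) (x : ℕ) : ℝ :=
  if 1 ≤ x ∧ x ≤ n then f x else 0

/-- The feasible points `(ρ, ν)` of the linear program. -/
def LPFeasible (n : ℕ) {m : ℕ} (b : Fin m → ℕ → ℝ) (ρ ν : ℝ) : Prop :=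
  0 ≤ ν ∧ ν ≤ 1 ∧
  (∀ (j : Fin m) (u v : ℕ), u ≤ n → v ≤ n → u + v ≤ n → v ≤ u →
    0 ≤ zeroExtend n (b j) v * v - ρ * zeroExtend n (b j) u * u
      + ν * (zeroExtend n (b j) u * u - zeroExtend n (b j) (u + 1) * v)
      + b j 1 * (1 - ν) * ((u : ℝ) - v)) ∧
  (∀ (j : Fin m) (u v : ℕ), u ≤ n → v ≤ n → n < u + v → v ≤ u →
    0 ≤ zeroExtend n (b j) v * v - ρ * zeroExtend n (b j) u * u
      + ν * (zeroExtend n (b j) u * ((n : ℝ) - v)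
        - zeroExtend n (b j) (u + 1) * ((n : ℝ) - u))
      + b j 1 * (1 - ν) * ((u : ℝ) - v))

/-- `(ρ, ν)` solves the linear program: it is feasible and maximizes `ρ`. -/
def LPOptimal (n : ℕ) {m : ℕ} (b : Fin m → ℕ → ℝ) (ρ ν : ℝ) : Prop :=
  LPFeasible n b ρ ν ∧ ∀ ρ' ν', LPFeasible n b ρ' ν' → ρ' ≤ ρ

/-!
Take a resource with `u` users at an equilibrium and `v` users at an optimum. The left-hand side of
a constraint is its optimal cost, minus `ρ` times its equilibrium cost, plus `ν` times what is saved
there by all unilateral deviations to the optimum, when the two groups of users overlap as little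
as `n` agents allow. By monotonicity the inequality persists for larger overlaps and for `u < v`, so
adding it up over the resources shows that every game is smooth, and `1 / ρ` bounds the price of
anarchy even for coarse correlated equilibria.

Conversely, let a toll have pure price of anarchy at most `1 / r`. If the savings for two
constraints, taken with natural multiplicities `p` and `q`, have a nonpositive sum, then in the game
with `p` and `q` cycles of `n` resources, on which the agents choose between rotations of two
patterns, it is an equilibrium that all use the first pattern, and the price of anarchy bounds its
cost by that of the second. By a Farkas alternative these comparisons yield a common multiplier
`ν`. The constraint for `u = 0`, `v = 1` says that `ν` times the toll on `b j` is at most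
`(1 - ν) * b j 1`, so that `(r, ν)` is feasible and `r` is at most the optimum of the program.

At `ν = 0` the program only says `ρ * b j n ≤ b j 1`. If `ρ < 1` there, then increasing `ν` makes
all tight constraints with `u > 0` slack, which leaves room to increase `ρ`.
-/

open scoped Finset Topology

/-- The total amount saved on a resource with `u` users when every agent in turn deviates
unilaterally to an allocation in which it has `v` users, `z` of whom use it in both allocations.
Here `c x` is what each of `x` users pays, tolls included. -/
def deviationGain (c : ℕ → ℝ) (u v z : ℕ) : ℝ :=
  ((u : ℝ) - z) * c u - ((v : ℝ) - z) * c (u + 1)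

section DeviationGain

variable {n u v : ℕ} {c : ℕ → ℝ}

theorem deviationGain_add_const (c : ℕ → ℝ) (τ : ℝ) (u v z : ℕ) :
    deviationGain (fun x => c x + τ) u v z = deviationGain c u v z + τ * ((u : ℝ) - v) := by
  unfold deviationGain
  ring

theorem deviationGain_mono_overlap {z z' : ℕ} (hc : c u ≤ c (u + 1)) (hz : z ≤ z') :
    deviationGain c u v z ≤ deviationGain c u v z' := by
  have hz : (z : ℝ) ≤ z' := mod_cast hz
  unfold deviationGain
  nlinarith

theorem deviationGain_card {α : Type*} [DecidableEq α] (c : ℕ → ℝ) (s t : Finset α) :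
    deviationGain c #s #t #(s ∩ t) = #(s \ t) * c #s - #(t \ s) * c (#s + 1) := by
  have hst : (#(s \ t) : ℝ) + #(s ∩ t) = #s := mod_cast Finset.card_sdiff_add_card_inter s t
  have hts : (#(t \ s) : ℝ) + #(s ∩ t) = #t := by
    rw [Finset.inter_comm]
    exact mod_cast Finset.card_sdiff_add_card_inter t s
  rw [deviationGain, ← eq_sub_of_add_eq hst, ← eq_sub_of_add_eq hts]

theorem zeroExtend_mul_self (hu : u ≤ n) (f : ℕ → ℝ) : zeroExtend n f u * u = f u * u := by
  rcases u.eq_zero_or_pos with rfl | hu₀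
  · simp
  · rw [zeroExtend, if_pos ⟨hu₀, hu⟩]

theorem deviationGain_of_add_le (huv : u + v ≤ n) (f : ℕ → ℝ) :
    deviationGain f u v (u + v - n) = zeroExtend n f u * u - zeroExtend n f (u + 1) * v := by
  rw [zeroExtend_mul_self (by omega), deviationGain, Nat.sub_eq_zero_of_le huv]
  rcases v.eq_zero_or_pos with rfl | hv
  · simp [mul_comm]
  · rw [zeroExtend, if_pos (by omega)]
    simp [mul_comm]

theorem deviationGain_of_lt_add (hu : u ≤ n) (hv : v ≤ n) (huv : n < u + v) (f : ℕ → ℝ) :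
    deviationGain f u v (u + v - n)
      = zeroExtend n f u * ((n : ℝ) - v) - zeroExtend n f (u + 1) * ((n : ℝ) - u) := by
  rw [deviationGain, Nat.cast_sub huv.le, zeroExtend, if_pos (by omega)]
  rcases hu.eq_or_lt with rfl | hlt
  · push_cast
    ring
  · rw [zeroExtend, if_pos (by omega)]
    push_cast
    ring

theorem deviationGain_of_eq_succ (hu : u ≤ n) (hc : u < n → c (u + 1) = c u) :
    deviationGain c u v (u + v - n) = c u * ((u : ℝ) - v) := by
  rcases hu.eq_or_lt with rfl | hlt
  · simp [deviationGain, mul_comm]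
  · rw [deviationGain, hc hlt]
    ring

theorem deviationGain_minOverlap_le {z : ℕ} (hc : MonotoneOn c (Set.Icc 1 n)) (hvu : v ≤ u)
    (hu : u ≤ n) (hzu : z ≤ u) (hzv : z ≤ v) (hz : u + v ≤ n + z) :
    deviationGain c u v (u + v - n) ≤ deviationGain c u v z := by
  rcases u.eq_zero_or_pos with rfl | hu₀
  · obtain rfl : v = 0 := by omega
    obtain rfl : z = 0 := by omega
    simp
  rcases hu.eq_or_lt with rfl | hlt
  · obtain rfl : v = z := by omega
    simp
  · exact deviationGain_mono_overlap (hc ⟨hu₀, hu⟩ ⟨by omega, hlt⟩ u.le_succ) (by omega)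

end DeviationGain

/-- The left-hand side of a constraint of the linear program, for an arbitrary overlap `z` and an
arbitrary coefficient `σ` of `u - v`. The program has `z = u + v - n` (truncated subtraction: the
smallest overlap that `n` agents allow) and `σ = (1 - ν) * f 1`; the untruncated `f` is used, since
`zeroExtend n f` differs from it only where its coefficient vanishes. -/
def constraintSlack (f : ℕ → ℝ) (ρ ν σ : ℝ) (u v z : ℕ) : ℝ :=
  f v * v - ρ * (f u * u) + ν * deviationGain f u v z + σ * ((u : ℝ) - v)

theorem constraintSlack_mul (f : ℕ → ℝ) (ρ ν τ : ℝ) (u v z : ℕ) :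
    constraintSlack f ρ ν (ν * τ) u v z
      = f v * v - ρ * (f u * u) + ν * deviationGain (fun x => f x + τ) u v z := by
  rw [deviationGain_add_const, constraintSlack]
  ring

theorem constraintSlack_sum_mul {ι : Type*} (s : Finset ι) (α σ : ι → ℝ) (f : ι → ℕ → ℝ)
    (ρ ν : ℝ) (u v z : ℕ) :
    constraintSlack (fun x => ∑ j ∈ s, α j * f j x) ρ ν (∑ j ∈ s, α j * σ j) u v z
      = ∑ j ∈ s, α j * constraintSlack (f j) ρ ν (σ j) u v z := by
  simp only [constraintSlack, deviationGain, Finset.sum_mul, Finset.mul_sum,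
    ← Finset.sum_sub_distrib, ← Finset.sum_add_distrib]
  exact Finset.sum_congr rfl fun j _ => by ring

theorem lpFeasible_iff {n m : ℕ} {b : Fin m → ℕ → ℝ} {ρ ν : ℝ} :
    LPFeasible n b ρ ν ↔ 0 ≤ ν ∧ ν ≤ 1 ∧ ∀ (j : Fin m) (u v : ℕ), v ≤ u → u ≤ n →
      0 ≤ constraintSlack (b j) ρ ν ((1 - ν) * b j 1) u v (u + v - n) := by
  unfold LPFeasible constraintSlack
  refine and_congr_right fun _ => and_congr_right fun _ => ⟨?_, fun h => ⟨?_, ?_⟩⟩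
  · rintro ⟨hle, hlt⟩ j u v hvu hu
    have hv := hvu.trans hu
    rw [← zeroExtend_mul_self hv, ← zeroExtend_mul_self hu, ← mul_assoc, mul_comm (1 - ν)]
    rcases le_or_gt (u + v) n with huv | huv
    · rw [deviationGain_of_add_le huv]
      exact hle j u v hu hv huv hvu
    · rw [deviationGain_of_lt_add hu hv huv]
      exact hlt j u v hu hv huv hvu
  · intro j u v hu hv huv hvu
    rw [← deviationGain_of_add_le huv, mul_assoc ρ, zeroExtend_mul_self hu, zeroExtend_mul_self hv,
      mul_comm (b j 1)]
    exact h j u v hvu hu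
  · intro j u v hu hv huv hvu
    rw [← deviationGain_of_lt_add hu hv huv, mul_assoc ρ, zeroExtend_mul_self hu,
      zeroExtend_mul_self hv, mul_comm (b j 1)]
    exact h j u v hvu hu

section ConstraintSlack

variable {n u v z : ℕ} {f : ℕ → ℝ} {ρ ν : ℝ}

theorem pos_of_monotoneOn_Icc (hf₁ : 0 < f 1) (hf : MonotoneOn f (Set.Icc 1 n)) {x : ℕ}
    (hx : x ∈ Set.Icc 1 n) : 0 < f x :=
  hf₁.trans_le (hf ⟨le_rfl, hx.1.trans hx.2⟩ hx hx.1)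

theorem mul_cast_le_mul_cast_of_monotoneOn_Icc (hf : MonotoneOn f (Set.Icc 1 n)) (hv : v ≤ n) :
    f 1 * v ≤ f v * v := by
  rcases v.eq_zero_or_pos with rfl | hv₀
  · simp
  · exact mul_le_mul_of_nonneg_right (hf ⟨le_rfl, hv₀.trans_le hv⟩ ⟨hv₀, hv⟩ hv₀) v.cast_nonneg

theorem mul_mul_cast_le_of_monotoneOn_Icc (hf : MonotoneOn f (Set.Icc 1 n)) (hρ : 0 ≤ ρ)
    (hρn : ρ * f n ≤ f 1) (hu : u ≤ n) : ρ * (f u * u) ≤ f 1 * u := by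
  rcases u.eq_zero_or_pos with rfl | hu₀
  · simp
  · have hfu : f u ≤ f n := hf ⟨hu₀, hu⟩ ⟨hu₀.trans_le hu, le_rfl⟩ hu
    rw [← mul_assoc]
    gcongr
    exact (mul_le_mul_of_nonneg_left hfu hρ).trans hρn

theorem constraintSlack_zero_nonneg (hf : MonotoneOn f (Set.Icc 1 n)) (hρ : 0 ≤ ρ)
    (hρn : ρ * f n ≤ f 1) (hu : u ≤ n) (hv : v ≤ n) :
    0 ≤ constraintSlack f ρ 0 (f 1) u v z := by
  have := mul_cast_le_mul_cast_of_monotoneOn_Icc hf hv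
  have := mul_mul_cast_le_of_monotoneOn_Icc hf hρ hρn hu
  unfold constraintSlack
  linarith

theorem constraintSlack_add_mul (f : ℕ → ℝ) (ρ κ ε : ℝ) (u v z : ℕ) :
    constraintSlack f (ρ + ε * κ) ε ((1 - ε) * f 1) u v z = constraintSlack f ρ 0 (f 1) u v z
      + ε * (deviationGain f u v z - f 1 * ((u : ℝ) - v) - κ * (f u * u)) := by
  unfold constraintSlack
  ring

theorem eq_of_constraintSlack_zero_eq_zero (hf : MonotoneOn f (Set.Icc 1 n)) (hρ : 0 < ρ)
    (hρn : ρ * f n ≤ f 1) (hu₀ : 0 < u) (hu : u ≤ n) (hv : v ≤ n)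
    (htight : constraintSlack f ρ 0 (f 1) u v z = 0) :
    f 1 = ρ * f u ∧ f u = f n ∧ f v * v = f 1 * v := by
  have hv₁ := mul_cast_le_mul_cast_of_monotoneOn_Icc hf hv
  have hu₁ := mul_mul_cast_le_of_monotoneOn_Icc hf hρ.le hρn hu
  unfold constraintSlack at htight
  have hfu : f 1 = ρ * f u :=
    mul_right_cancel₀ (Nat.cast_ne_zero.2 hu₀.ne' : (u : ℝ) ≠ 0) (by linarith)
  refine ⟨hfu, le_antisymm (hf ⟨hu₀, hu⟩ ⟨hu₀.trans_le hu, le_rfl⟩ hu) ?_, by linarith⟩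
  exact le_of_mul_le_mul_left (hρn.trans_eq hfu) hρ

theorem mul_le_deviationGain_sub_of_tight (hf₁ : 0 < f 1) (hf : MonotoneOn f (Set.Icc 1 n))
    (hρ : 0 < ρ) (hρ₁ : ρ < 1) (hρn : ρ * f n ≤ f 1) (hvu : v ≤ u) (hu : u ≤ n)
    (htight : constraintSlack f ρ 0 (f 1) u v (u + v - n) = 0) :
    (1 - ρ) / n * (f u * u) ≤ deviationGain f u v (u + v - n) - f 1 * ((u : ℝ) - v) := by
  rcases u.eq_zero_or_pos with rfl | hu₀
  · obtain rfl : v = 0 := by omega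
    simp [deviationGain]
  obtain ⟨hfu, hfun, hfv⟩ :=
    eq_of_constraintSlack_zero_eq_zero hf hρ hρn hu₀ hu (hvu.trans hu) htight
  have hfu₀ : 0 < f u := pos_of_monotoneOn_Icc hf₁ hf ⟨hu₀, hu⟩
  have hne : v ≠ u := by
    rintro rfl
    have := mul_right_cancel₀ (Nat.cast_ne_zero.2 hu₀.ne' : (v : ℝ) ≠ 0) hfv
    nlinarith
  have hvu' : (v : ℝ) + 1 ≤ u := mod_cast hvu.lt_of_ne hne
  have hsucc : u < n → f (u + 1) = f u := fun hlt =>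
    le_antisymm (hfun ▸ hf ⟨by omega, hlt⟩ ⟨by omega, le_rfl⟩ hlt)
      (hf ⟨hu₀, hu⟩ ⟨by omega, hlt⟩ u.le_succ)
  have hun : (u : ℝ) / n ≤ 1 := div_le_one_of_le₀ (mod_cast hu) n.cast_nonneg
  calc (1 - ρ) / n * (f u * u) = (1 - ρ) * f u * (u / n) := by ring
    _ ≤ (1 - ρ) * f u * ((u : ℝ) - v) :=
      mul_le_mul_of_nonneg_left (by linarith) (mul_nonneg (sub_nonneg.2 hρ₁.le) hfu₀.le)
    _ = deviationGain f u v (u + v - n) - f 1 * ((u : ℝ) - v) := by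
      rw [deviationGain_of_eq_succ hu hsucc, hfu]
      ring

/-- For `u < v` the constraints follow from monotonicity, so that the program omits them. -/
theorem constraintSlack_nonneg_of_lt (hf₁ : 0 < f 1) (hf : MonotoneOn f (Set.Icc 1 n))
    (hρ : ρ ≤ 1) (hν₀ : 0 ≤ ν) (hν₁ : ν ≤ 1) (huv : u < v) (hv : v ≤ n) (hzu : z ≤ u) :
    0 ≤ constraintSlack f ρ ν ((1 - ν) * f 1) u v z := by
  have huv' : (u : ℝ) ≤ v := mod_cast huv.le
  have hsucc : f (u + 1) ≤ f v := hf ⟨by omega, by omega⟩ ⟨by omega, hv⟩ huv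
  have hone : f 1 ≤ f (u + 1) := hf ⟨le_rfl, by omega⟩ ⟨by omega, by omega⟩ (by omega)
  have hinc : 0 ≤ ((u : ℝ) - ν * (u - z)) * (f (u + 1) - f u) := by
    rcases u.eq_zero_or_pos with rfl | hu₀
    · simp [Nat.le_zero.1 hzu]
    · refine mul_nonneg ?_ (sub_nonneg.2 (hf ⟨hu₀, by omega⟩ ⟨by omega, by omega⟩ u.le_succ))
      linarith [mul_nonneg (sub_nonneg.2 hν₁) (u.cast_nonneg (α := ℝ)),
        mul_nonneg hν₀ (z.cast_nonneg (α := ℝ))]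
  have hfu : 0 ≤ f u * u := (mul_nonneg hf₁.le u.cast_nonneg).trans
    (mul_cast_le_mul_cast_of_monotoneOn_Icc hf (huv.le.trans hv))
  calc
    (0 : ℝ) ≤ (v : ℝ) * (f v - f (u + 1)) + (1 - ρ) * (f u * u)
        + ((v : ℝ) - u) * ((1 - ν) * (f (u + 1) - f 1))
        + ((u : ℝ) - ν * (u - z)) * (f (u + 1) - f u) := by
      have := mul_nonneg (v.cast_nonneg (α := ℝ)) (sub_nonneg.2 hsucc)
      have := mul_nonneg (sub_nonneg.2 hρ) hfu
      have := mul_nonneg (sub_nonneg.2 huv') (mul_nonneg (sub_nonneg.2 hν₁) (sub_nonneg.2 hone))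
      linarith
    _ = constraintSlack f ρ ν ((1 - ν) * f 1) u v z := by
      unfold constraintSlack deviationGain
      ring

theorem constraintSlack_one_one_eq_zero (hf : ∀ x ∈ Set.Icc 1 n, f x = f 1)
    (hu : u ≤ n) (hv : v ≤ n) : constraintSlack f 1 1 0 u v (u + v - n) = 0 := by
  have hmul : ∀ x ≤ n, f x * x = f 1 * x := fun x hx => by
    rcases x.eq_zero_or_pos with rfl | hx₀
    · simp
    · rw [hf x ⟨hx₀, hx⟩]
  rcases u.eq_zero_or_pos with rfl | hu₀
  · rw [constraintSlack, hmul v hv, deviationGain, Nat.sub_eq_zero_of_le (by omega)]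
    simp [mul_comm]
  · rw [constraintSlack, hmul v hv, deviationGain_of_eq_succ hu fun hlt =>
      (hf _ ⟨by omega, hlt⟩).trans (hf u ⟨hu₀, hu⟩).symm, hf u ⟨hu₀, hu⟩]
    ring

end ConstraintSlack

theorem eventually_nonneg_add_mul {a c : ℝ} (ha : 0 ≤ a) (hc : a = 0 → 0 ≤ c) :
    ∀ᶠ ε in 𝓝[>] (0 : ℝ), 0 ≤ a + ε * c := by
  rcases ha.eq_or_lt with h | h
  · filter_upwards [self_mem_nhdsWithin] with ε hε
    simpa [← h] using mul_nonneg (le_of_lt hε) (hc h.symm)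
  · have hcont : ContinuousAt (fun ε : ℝ => a + ε * c) 0 := by fun_prop
    refine Filter.Eventually.filter_mono nhdsWithin_le_nhds ?_
    filter_upwards [hcont.eventually_const_lt (u := 0) (by simpa using h)] with ε hε using hε.le

section LinearProgram

variable {n m : ℕ} {b : Fin m → ℕ → ℝ} {ρ ν : ℝ}

theorem LPFeasible.le_one (h : LPFeasible n b ρ ν) (hn : 0 < n) {j : Fin m} (hj : 0 < b j n) :
    ρ ≤ 1 := by
  have hslack := (lpFeasible_iff.1 h).2.2 j n n le_rfl le_rfl
  have hpos : 0 < b j n * n := mul_pos hj (Nat.cast_pos.2 hn)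
  have : 0 ≤ (1 - ρ) * (b j n * n) := by
    simpa [constraintSlack, deviationGain, sub_mul] using hslack
  linarith [nonneg_of_mul_nonneg_left this hpos]

theorem lpFeasible_zero (hmono : ∀ j, MonotoneOn (b j) (Set.Icc 1 n)) (hρ : 0 ≤ ρ)
    (hρn : ∀ j, ρ * b j n ≤ b j 1) : LPFeasible n b ρ 0 := by
  refine lpFeasible_iff.2 ⟨le_rfl, zero_le_one, fun j u v hvu hu => ?_⟩
  rw [sub_zero, one_mul]
  exact constraintSlack_zero_nonneg (hmono j) hρ (hρn j) hu (hvu.trans hu)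

theorem LPFeasible.mul_le_of_zero (h : LPFeasible n b ρ 0) (hn : 0 < n) (j : Fin m) :
    ρ * b j n ≤ b j 1 := by
  have hslack := (lpFeasible_iff.1 h).2.2 j n 0 n.zero_le le_rfl
  have : 0 ≤ (b j 1 - ρ * b j n) * n := by
    simp only [constraintSlack, Nat.cast_zero] at hslack
    linarith
  exact sub_nonneg.1 (nonneg_of_mul_nonneg_left this (Nat.cast_pos.2 hn))

theorem LPOptimal.pos (h : LPOptimal n b ρ ν) (h₁ : ∀ j, 0 < b j 1)
    (hmono : ∀ j, MonotoneOn (b j) (Set.Icc 1 n)) : 0 < ρ := by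
  have hsmall : ∀ᶠ r in 𝓝[>] (0 : ℝ), ∀ j, 0 ≤ b j 1 + r * -b j n :=
    Filter.eventually_all.2 fun j =>
      eventually_nonneg_add_mul (h₁ j).le fun h₀ => absurd h₀ (h₁ j).ne'
  obtain ⟨r, hr, hr₀ : 0 < r⟩ := (hsmall.and self_mem_nhdsWithin).exists
  exact hr₀.trans_le (h.2 r 0 (lpFeasible_zero hmono hr₀.le fun j => by linarith [hr j]))

theorem isClosed_setOf_lpFeasible : IsClosed {q : ℝ × ℝ | LPFeasible n b q.1 q.2} := by
  simp only [lpFeasible_iff, constraintSlack, Set.ofPred_and, Set.ofPred_forall]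
  refine (isClosed_le continuous_const continuous_snd).inter
    ((isClosed_le continuous_snd continuous_const).inter ?_)
  refine isClosed_iInter fun j => isClosed_iInter fun u => isClosed_iInter fun v =>
    isClosed_iInter fun _ => isClosed_iInter fun _ => isClosed_le continuous_const ?_
  fun_prop

theorem exists_lpOptimal (hn : 0 < n) (hm : 0 < m) (h₁ : ∀ j, 0 < b j 1)
    (hmono : ∀ j, MonotoneOn (b j) (Set.Icc 1 n)) : ∃ ρ ν, LPOptimal n b ρ ν := by
  let S : Set (ℝ × ℝ) := {q | 0 ≤ q.1} ∩ {q | LPFeasible n b q.1 q.2}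
  have hpos : 0 < b ⟨0, hm⟩ n := pos_of_monotoneOn_Icc (h₁ _) (hmono _) ⟨hn, le_rfl⟩
  have hsub : S ⊆ Set.Icc 0 1 ×ˢ Set.Icc 0 1 := fun q hq =>
    ⟨⟨hq.1, hq.2.le_one hn hpos⟩, hq.2.1, hq.2.2.1⟩
  have hcompact : IsCompact S := (isCompact_Icc.prod isCompact_Icc).of_isClosed_subset
    ((isClosed_le continuous_const continuous_fst).inter isClosed_setOf_lpFeasible) hsub
  have hne : S.Nonempty :=
    ⟨(0, 0), le_refl (0 : ℝ), lpFeasible_zero hmono le_rfl fun j => by simpa using (h₁ j).le⟩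
  obtain ⟨q, hq, hmax⟩ := hcompact.exists_isMaxOn hne continuousOn_fst
  refine ⟨q.1, q.2, hq.2, fun ρ' ν' h => ?_⟩
  rcases le_total 0 ρ' with hρ' | hρ'
  · exact hmax (show (ρ', ν') ∈ S from ⟨hρ', h⟩)
  · exact hρ'.trans hq.1

theorem LPFeasible.exists_lt_of_zero (h : LPFeasible n b ρ 0) (hn : 0 < n) (h₁ : ∀ j, 0 < b j 1)
    (hmono : ∀ j, MonotoneOn (b j) (Set.Icc 1 n)) (hρ : 0 < ρ) (hρ₁ : ρ < 1) :
    ∃ ρ' ν', ρ < ρ' ∧ LPFeasible n b ρ' ν' := by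
  have hρn := h.mul_le_of_zero hn
  have hfeas : ∀ᶠ ε in 𝓝[>] (0 : ℝ), ∀ k : Fin m × Fin (n + 1) × Fin (n + 1), k.2.2 ≤ k.2.1 →
      0 ≤ constraintSlack (b k.1) (ρ + ε * ((1 - ρ) / n)) ε ((1 - ε) * b k.1 1) k.2.1 k.2.2
        (k.2.1 + k.2.2 - n) := by
    refine Filter.eventually_all.2 fun ⟨j, u, v⟩ =>
      Filter.eventually_imp_distrib_left.2 fun hvu => ?_
    have hu : (u : ℕ) ≤ n := Nat.le_of_lt_succ u.2
    have hv : (v : ℕ) ≤ n := Nat.le_of_lt_succ v.2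
    simp only [constraintSlack_add_mul]
    exact eventually_nonneg_add_mul (constraintSlack_zero_nonneg (hmono j) hρ.le (hρn j) hu hv)
      fun htight => sub_nonneg.2
        (mul_le_deviationGain_sub_of_tight (h₁ j) (hmono j) hρ hρ₁ (hρn j) hvu hu htight)
  obtain ⟨ε, hε, hε₀, hε₁⟩ := (hfeas.and (Ioo_mem_nhdsGT zero_lt_one)).exists
  refine ⟨ρ + ε * ((1 - ρ) / n), ε, lt_add_of_pos_right ρ ?_,
    lpFeasible_iff.2 ⟨hε₀.le, hε₁.le, fun j u v hvu hu => ?_⟩⟩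
  · exact mul_pos hε₀ (div_pos (sub_pos.2 hρ₁) (Nat.cast_pos.2 hn))
  · exact hε (j, ⟨u, by omega⟩, ⟨v, by omega⟩) hvu

theorem LPOptimal.pos_snd (h : LPOptimal n b ρ ν) (hn : 0 < n) (h₁ : ∀ j, 0 < b j 1)
    (hmono : ∀ j, MonotoneOn (b j) (Set.Icc 1 n)) (hb : ∃ j, b j 1 < b j n) : 0 < ν := by
  refine h.1.1.lt_of_ne' fun hν => ?_
  subst hν
  obtain ⟨j, hj⟩ := hb
  have hρ₁ : ρ < 1 := lt_of_mul_lt_mul_right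
    (by simpa using (h.1.mul_le_of_zero hn j).trans_lt hj) ((h₁ j).trans hj).le
  obtain ⟨ρ', ν', hlt, hfeas⟩ := h.1.exists_lt_of_zero hn h₁ hmono (h.pos h₁ hmono) hρ₁
  exact (h.2 ρ' ν' hfeas).not_gt hlt

theorem lpOptimal_one_of_const (hn : 0 < n) (hm : 0 < m) (h₁ : ∀ j, 0 < b j 1)
    (hconst : ∀ j, ∀ x ∈ Set.Icc 1 n, b j x = b j 1) : LPOptimal n b 1 1 := by
  refine ⟨lpFeasible_iff.2 ⟨zero_le_one, le_rfl, fun j u v hvu hu => ?_⟩, fun ρ' ν' h => ?_⟩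
  · rw [sub_self, zero_mul, constraintSlack_one_one_eq_zero (hconst j) hu (hvu.trans hu)]
  · exact h.le_one hn ((h₁ _).trans_eq (hconst ⟨0, hm⟩ n ⟨hn, le_rfl⟩).symm)

theorem exists_lpOptimal_pos (hn : 0 < n) (hm : 0 < m) (h₁ : ∀ j, 0 < b j 1)
    (hmono : ∀ j, MonotoneOn (b j) (Set.Icc 1 n)) : ∃ ρ ν, LPOptimal n b ρ ν ∧ 0 < ν := by
  by_cases hb : ∃ j, b j 1 < b j n
  · obtain ⟨ρ, ν, h⟩ := exists_lpOptimal hn hm h₁ hmono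
    exact ⟨ρ, ν, h, h.pos_snd hn h₁ hmono hb⟩
  · push Not at hb
    refine ⟨1, 1, lpOptimal_one_of_const hn hm h₁ fun j x hx => le_antisymm ?_ ?_, one_pos⟩
    · exact (hmono j hx ⟨hn, le_rfl⟩ hx.2).trans (hb j)
    · exact hmono j ⟨le_rfl, hn⟩ hx hx.1

end LinearProgram

theorem exists_nat_mul_lt_mul {a b c d : ℝ} (ha : 0 ≤ a) (hb : 0 < b) (hd : 0 < d)
    (h : a * d < c * b) : ∃ p q : ℕ, a * q < p * b ∧ p * d < c * q := by
  obtain ⟨r, har, hrc⟩ := exists_rat_btwn ((div_lt_div_iff₀ hb hd).2 h)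
  lift r to ℚ≥0 using mod_cast (div_nonneg ha hb.le).trans har.le
  have hr : (((r : ℚ≥0) : ℚ) : ℝ) = r.num / r.den := by
    rw [Rat.cast_nnratCast, NNRat.cast_def]
  have hden : (0 : ℝ) < r.den := mod_cast r.den_pos
  rw [hr] at har hrc
  exact ⟨r.num, r.den, (div_lt_div_iff₀ hb hden).1 har, (div_lt_div_iff₀ hden hd).1 hrc⟩

theorem mul_le_mul_of_nat_combination {a b a' b' : ℝ} (hb : 0 < b) (hb' : b' ≤ 0)
    (h : ∀ p q : ℕ, p * b + q * b' ≤ 0 → 0 ≤ p * a + q * a') : a * b' ≤ a' * b := by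
  have ha' : 0 ≤ a' := by simpa using h 0 1 (by simpa using hb')
  by_contra! hlt
  have ha : 0 < -a := by
    by_contra! ha
    exact hlt.not_ge ((mul_nonpos_of_nonneg_of_nonpos (by linarith) hb').trans
      (mul_nonneg ha' hb.le))
  obtain ⟨p, q, hp, hq⟩ := exists_nat_mul_lt_mul (c := -b') ha' ha hb (by linarith)
  have := h p q (by linarith)
  linarith

theorem exists_nonneg_add_mul_nonneg_of_pos {a b a' b' : ℝ} (hb : 0 < b)
    (h : ∀ p q : ℕ, p * b + q * b' ≤ 0 → 0 ≤ p * a + q * a') :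
    ∃ ν ≥ 0, 0 ≤ a + ν * b ∧ 0 ≤ a' + ν * b' := by
  rcases le_or_gt b' 0 with hb' | hb'
  · have ha' : 0 ≤ a' := by simpa using h 0 1 (by simpa using hb')
    refine ⟨max 0 (-a / b), le_max_left _ _, ?_, ?_⟩
    · have := (div_le_iff₀ hb).1 (le_max_right 0 (-a / b))
      linarith
    · rcases max_cases 0 (-a / b) with ⟨hmax, -⟩ | ⟨hmax, -⟩ <;> rw [hmax]
      · simpa using ha'
      · have := mul_le_mul_of_nat_combination hb hb' h
        have : a' + -a / b * b' = (a' * b - a * b') / b := by field_simp; ring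
        rw [this]
        exact div_nonneg (by linarith) hb.le
  · refine ⟨|a| / b + |a'| / b', by positivity, ?_, ?_⟩
    · have : (|a| / b + |a'| / b') * b = |a| + |a'| / b' * b := by field_simp
      have : 0 ≤ |a'| / b' * b := by positivity
      linarith [neg_abs_le a]
    · have : (|a| / b + |a'| / b') * b' = |a| / b * b' + |a'| := by field_simp
      have : 0 ≤ |a| / b * b' := by positivity
      linarith [neg_abs_le a']

theorem exists_nonneg_add_mul_nonneg {a b a' b' : ℝ}
    (h : ∀ p q : ℕ, p * b + q * b' ≤ 0 → 0 ≤ p * a + q * a') :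
    ∃ ν ≥ 0, 0 ≤ a + ν * b ∧ 0 ≤ a' + ν * b' := by
  rcases lt_or_ge 0 b with hb | hb
  · exact exists_nonneg_add_mul_nonneg_of_pos hb h
  rcases lt_or_ge 0 b' with hb' | hb'
  · obtain ⟨ν, hν, h', h''⟩ := exists_nonneg_add_mul_nonneg_of_pos (a := a') (a' := a) hb'
      fun p q hpq => add_comm (q * a : ℝ) _ ▸ h q p (add_comm (p * b' : ℝ) _ ▸ hpq)
    exact ⟨ν, hν, h'', h'⟩
  · exact ⟨0, le_rfl, by simpa using h 1 0 (by simpa using hb),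
      by simpa using h 0 1 (by simpa using hb')⟩

/-- A Farkas alternative with natural multipliers. By Helly's theorem on the line it suffices to
satisfy any two of the inequalities. -/
theorem exists_nonneg_forall_add_mul_nonneg {ι : Type*} [Finite ι] {a b : ι → ℝ}
    (h : ∀ (i j : ι) (p q : ℕ), p * b i + q * b j ≤ 0 → 0 ≤ p * a i + q * a j) :
    ∃ ν ≥ 0, ∀ i, 0 ≤ a i + ν * b i := by
  classical
  cases nonempty_fintype ι
  rcases isEmpty_or_nonempty ι with hι | ⟨⟨i₀⟩⟩
  · exact ⟨0, le_rfl, isEmptyElim⟩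
  let F : ι → Set ℝ := fun i => {ν | 0 ≤ ν ∧ 0 ≤ a i + ν * b i}
  have hconv : ∀ i ∈ Finset.univ, Convex ℝ (F i) := fun i _ => by
    have hhalf : Convex ℝ {ν : ℝ | 0 ≤ a i + ν * b i} := by
      simpa [neg_le_iff_add_nonneg'] using
        convex_halfSpace_ge (LinearMap.mulRight ℝ (b i)).isLinear (-a i)
    exact (convex_Ici 0).inter hhalf
  have hpair : ∀ I ⊆ (Finset.univ : Finset ι), #I ≤ Module.finrank ℝ ℝ + 1 →
      (⋂ i ∈ I, F i).Nonempty := fun I _ hI => by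
    rw [Module.finrank_self] at hI
    rcases I.eq_empty_or_nonempty with rfl | ⟨i, hi⟩
    · simp
    have : Nonempty ι := ⟨i⟩
    obtain ⟨j, hj⟩ : ∃ j, I.erase i ⊆ {j} := Finset.card_le_one_iff_subset_singleton.1 <| by
      rw [Finset.card_erase_of_mem hi]; omega
    obtain ⟨ν, hν, hνi, hνj⟩ := exists_nonneg_add_mul_nonneg (h i j)
    refine ⟨ν, Set.mem_iInter₂.2 fun k hk => ?_⟩
    by_cases hki : k = i
    · exact hki ▸ ⟨hν, hνi⟩
    · rw [Finset.mem_singleton.1 (hj (Finset.mem_erase.2 ⟨hki, hk⟩))]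
      exact ⟨hν, hνj⟩
  obtain ⟨ν, hν⟩ := Convex.helly_theorem' hconv hpair
  have hν : ∀ i, ν ∈ F i := by simpa using hν
  exact ⟨ν, (hν i₀).1, fun i => (hν i).2⟩

theorem sum_sum_eq_sum_card_mul {ι κ : Type*} [Fintype ι] [Fintype κ] {S : ι → Finset κ}
    {U : κ → Finset ι} (h : ∀ i e, e ∈ S i ↔ i ∈ U e) (g : κ → ℝ) :
    ∑ i, ∑ e ∈ S i, g e = ∑ e, #(U e) * g e := by
  rw [Finset.sum_comm' (t' := Finset.univ) (s' := U) (by simp [h])]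
  simp only [Finset.sum_const, nsmul_eq_mul]

namespace CongestionGame

variable {n : ℕ} {L : Set (ℕ → ℝ)} (G : CongestionGame n L)

/-- The agents using the resource `e`; there are `G.load a e` of them. -/
def users (a : G.Allocation) (e : G.Resource) : Finset (Fin G.numAgents) :=
  Finset.univ.filter fun i => e ∈ (a i).1

theorem mem_users {a : G.Allocation} {e : G.Resource} {i : Fin G.numAgents} :
    i ∈ G.users a e ↔ e ∈ (a i).1 :=
  Finset.mem_filter_univ i

theorem card_users (a : G.Allocation) (e : G.Resource) : #(G.users a e) = G.load a e := rfl

/-- The number of agents using the resource `e` in both allocations. -/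
def overlap (a a' : G.Allocation) (e : G.Resource) : ℕ :=
  #(G.users a e ∩ G.users a' e)

theorem load_le (a : G.Allocation) (e : G.Resource) : G.load a e ≤ n :=
  (Finset.card_le_univ _).trans (by simpa using G.numAgents_le)

theorem load_add_load_le (a a' : G.Allocation) (e : G.Resource) :
    G.load a e + G.load a' e ≤ n + G.overlap a a' e := by
  rw [← card_users, ← card_users, overlap, ← Finset.card_union_add_card_inter]
  exact Nat.add_le_add_right ((card_finset_fin_le _).trans G.numAgents_le) _

theorem users_update {a : G.Allocation} {i : Fin G.numAgents}
    {A : {A : Finset G.Resource // A ∈ G.actions i}} {e : G.Resource} (he : e ∈ A.1) :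
    G.users (Function.update a i A) e = insert i (G.users a e) := by
  ext k
  by_cases hk : k = i
  · subst hk
    simp [mem_users, he]
  · simp [mem_users, hk]

theorem load_update_of_mem {a : G.Allocation} {i : Fin G.numAgents}
    {A : {A : Finset G.Resource // A ∈ G.actions i}} {e : G.Resource} (he : e ∈ A.1)
    (hi : e ∈ (a i).1) : G.load (Function.update a i A) e = G.load a e := by
  rw [← card_users, users_update G he, Finset.insert_eq_of_mem (G.mem_users.2 hi), card_users]

theorem load_update_of_notMem {a : G.Allocation} {i : Fin G.numAgents}
    {A : {A : Finset G.Resource // A ∈ G.actions i}} {e : G.Resource} (he : e ∈ A.1)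
    (hi : e ∉ (a i).1) : G.load (Function.update a i A) e = G.load a e + 1 := by
  rw [← card_users, users_update G he, Finset.card_insert_of_notMem (mt G.mem_users.1 hi),
    card_users]

theorem systemCost_eq_sum_load (a : G.Allocation) :
    G.systemCost a = ∑ e, G.load a e * G.cost e (G.load a e) :=
  sum_sum_eq_sum_card_mul (fun _ _ => G.mem_users.symm) fun e => G.cost e (G.load a e)

theorem systemCost_nonneg (hL : ∀ ℓ ∈ L, ∀ x ∈ Set.Icc 1 n, 0 ≤ ℓ x) (a : G.Allocation) :
    0 ≤ G.systemCost a := by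
  rw [systemCost_eq_sum_load]
  refine Finset.sum_nonneg fun e _ => ?_
  rcases (G.load a e).eq_zero_or_pos with h | h
  · simp [h]
  · exact mul_nonneg (Nat.cast_nonneg _) (hL _ (G.cost_mem e) _ ⟨h, G.load_le a e⟩)

/-- What each user of the resource `e` pays when it has `x` users. -/
def tolledCost (T : LocalMechanism) (e : G.Resource) (x : ℕ) : ℝ :=
  G.cost e x + T (G.cost e) x

theorem agentCost_sub_agentCost_update (T : LocalMechanism) (a : G.Allocation)
    (i : Fin G.numAgents) (A : {A : Finset G.Resource // A ∈ G.actions i}) :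
    G.agentCost T a i - G.agentCost T (Function.update a i A) i
      = ∑ e ∈ (a i).1 \ A.1, G.tolledCost T e (G.load a e)
        - ∑ e ∈ A.1 \ (a i).1, G.tolledCost T e (G.load a e + 1) := by
  have hcost : ∀ a' : G.Allocation, G.agentCost T a' i
      = ∑ e ∈ (a' i).1, G.tolledCost T e (G.load a' e) := fun _ => rfl
  have hkeep : ∑ e ∈ A.1 ∩ (a i).1, G.tolledCost T e (G.load (Function.update a i A) e)
      = ∑ e ∈ (a i).1 ∩ A.1, G.tolledCost T e (G.load a e) := by
    rw [Finset.inter_comm]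
    refine Finset.sum_congr rfl fun e he => ?_
    rw [Finset.mem_inter] at he
    rw [load_update_of_mem G he.2 he.1]
  have hjoin : ∑ e ∈ A.1 \ (a i).1, G.tolledCost T e (G.load (Function.update a i A) e)
      = ∑ e ∈ A.1 \ (a i).1, G.tolledCost T e (G.load a e + 1) := by
    refine Finset.sum_congr rfl fun e he => ?_
    rw [Finset.mem_sdiff] at he
    rw [load_update_of_notMem G he.1 he.2]
  rw [hcost, hcost, Function.update_self, ← Finset.sum_inter_add_sum_sdiff (a i).1 A.1,
    ← Finset.sum_inter_add_sum_sdiff A.1 (a i).1, hkeep, hjoin]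
  ring

theorem sum_agentCost_sub_agentCost_update (T : LocalMechanism) (a a' : G.Allocation) :
    ∑ i, (G.agentCost T a i - G.agentCost T (Function.update a i (a' i)) i)
      = ∑ e, deviationGain (G.tolledCost T e) (G.load a e) (G.load a' e) (G.overlap a a' e) := by
  simp only [agentCost_sub_agentCost_update, Finset.sum_sub_distrib]
  rw [sum_sum_eq_sum_card_mul (U := fun e => G.users a e \ G.users a' e)
      (by simp [mem_users]) fun e => G.tolledCost T e (G.load a e),
    sum_sum_eq_sum_card_mul (U := fun e => G.users a' e \ G.users a e)
      (by simp [mem_users]) fun e => G.tolledCost T e (G.load a e + 1),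
    ← Finset.sum_sub_distrib]
  exact Finset.sum_congr rfl fun e _ =>
    (deviationGain_card (G.tolledCost T e) (G.users a e) (G.users a' e)).symm

instance : Nonempty G.Allocation := ⟨fun i => ⟨_, (G.actions_nonempty i).choose_spec⟩⟩

theorem nashCost_le_coarseCost (T : LocalMechanism) : G.nashCost T ≤ G.coarseCost T := by
  classical
  refine iSup₂_le fun a ha => ?_
  have hexpect : ∀ f : G.Allocation → ℝ,
      ∑ x, (Pi.single a 1 : G.Allocation → ℝ) x * f x = f a := fun f => by simp [Pi.single_apply]
  have hcoarse : G.IsCoarseCorrelated T (Pi.single a 1) := by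
    refine ⟨single_mem_stdSimplex ℝ a, fun i A => ?_⟩
    rw [hexpect fun x => G.agentCost T x i,
      hexpect fun x => G.agentCost T (Function.update x i A) i]
    exact ha i A
  rw [← hexpect G.systemCost]
  exact le_iSup₂ (f := fun (p : G.Allocation → ℝ) (_ : G.IsCoarseCorrelated T p) =>
    ENNReal.ofReal (∑ x, p x * G.systemCost x)) _ hcoarse

/-- Roughgarden's smoothness condition, scaled: the system cost of every allocation `a` is bounded
in terms of that of any other allocation and of the total gain of the unilateral deviations from
`a` to it. -/
def IsSmooth (T : LocalMechanism) (ρ ν : ℝ) : Prop :=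
  ∀ a a' : G.Allocation, ρ * G.systemCost a ≤ G.systemCost a'
    + ν * ∑ i, (G.agentCost T a i - G.agentCost T (Function.update a i (a' i)) i)

variable {G}

theorem IsSmooth.mul_sum_systemCost_le {T : LocalMechanism} {ρ ν : ℝ} (h : G.IsSmooth T ρ ν)
    (hν : 0 ≤ ν) {p : G.Allocation → ℝ} (hp : G.IsCoarseCorrelated T p) (a' : G.Allocation) :
    ρ * ∑ a, p a * G.systemCost a ≤ G.systemCost a' := by
  have hgain : ∑ a, p a * ∑ i, (G.agentCost T a i - G.agentCost T (Function.update a i (a' i)) i)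
      ≤ 0 := by
    simp only [Finset.mul_sum, mul_sub]
    rw [Finset.sum_comm]
    refine Finset.sum_nonpos fun i _ => ?_
    rw [Finset.sum_sub_distrib]
    exact sub_nonpos.2 (hp.2 i (a' i))
  calc ρ * ∑ a, p a * G.systemCost a = ∑ a, p a * (ρ * G.systemCost a) := by
        rw [Finset.mul_sum]
        exact Finset.sum_congr rfl fun a _ => mul_left_comm _ _ _
    _ ≤ ∑ a, p a * (G.systemCost a'
          + ν * ∑ i, (G.agentCost T a i - G.agentCost T (Function.update a i (a' i)) i)) :=
        Finset.sum_le_sum fun a _ => mul_le_mul_of_nonneg_left (h a a') (hp.1.1 a)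
    _ = G.systemCost a' + ν * ∑ a, p a
          * ∑ i, (G.agentCost T a i - G.agentCost T (Function.update a i (a' i)) i) := by
        simp only [mul_add, Finset.sum_add_distrib, mul_left_comm _ ν]
        rw [← Finset.sum_mul, hp.1.2, one_mul, Finset.mul_sum]
    _ ≤ G.systemCost a' :=
        add_le_of_nonpos_right (mul_nonpos_of_nonneg_of_nonpos hν hgain)

theorem IsSmooth.coarseCost_le {T : LocalMechanism} {ρ ν : ℝ} (h : G.IsSmooth T ρ ν)
    (hρ : 0 < ρ) (hν : 0 ≤ ν) : G.coarseCost T ≤ ENNReal.ofReal (1 / ρ) * G.minCost := by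
  obtain ⟨a', ha'⟩ := exists_eq_ciInf_of_finite
    (f := fun a : G.Allocation => ENNReal.ofReal (G.systemCost a))
  rw [minCost, ← ha', ← ENNReal.ofReal_mul (by positivity)]
  refine iSup₂_le fun p hp => ENNReal.ofReal_le_ofReal ?_
  rw [one_div, ← div_eq_inv_mul, le_div_iff₀' hρ]
  exact h.mul_sum_systemCost_le hν hp a'

end CongestionGame

theorem coarsePoA_le_of_isSmooth {n : ℕ} {L : Set (ℕ → ℝ)} {T : LocalMechanism} {ρ ν : ℝ}
    (h : ∀ G : CongestionGame n L, G.IsSmooth T ρ ν) (hρ : 0 < ρ) (hν : 0 ≤ ν) :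
    coarsePoA n L T ≤ ENNReal.ofReal (1 / ρ) :=
  iSup_le fun G => ENNReal.div_le_of_le_mul ((h G).coarseCost_le hρ hν)

theorem pureNashPoA_le_coarsePoA (n : ℕ) (L : Set (ℕ → ℝ)) (T : LocalMechanism) :
    pureNashPoA n L T ≤ coarsePoA n L T :=
  iSup_mono fun G => ENNReal.div_le_div_right (G.nashCost_le_coarseCost T) _

section Smoothness

variable {n m : ℕ} {b : Fin m → ℕ → ℝ} {ρ ν : ℝ}

theorem nonneg_of_mem_costClass {x : ℕ} (hx : ∀ j, 0 ≤ b j x) {ℓ : ℕ → ℝ}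
    (hℓ : ℓ ∈ costClass b) : 0 ≤ ℓ x := by
  obtain ⟨α, hα, rfl⟩ := hℓ
  exact Finset.sum_nonneg fun j _ => mul_nonneg (hα j) (hx j)

theorem LPFeasible.constraintSlack_nonneg (h : LPFeasible n b ρ ν) (h₁ : ∀ j, 0 < b j 1)
    (hmono : ∀ j, MonotoneOn (b j) (Set.Icc 1 n)) (j : Fin m) {u v z : ℕ} (hu : u ≤ n)
    (hv : v ≤ n) (hzu : z ≤ u) (hzv : z ≤ v) (hz : u + v ≤ n + z) :
    0 ≤ constraintSlack (b j) ρ ν ((1 - ν) * b j 1) u v z := by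
  obtain ⟨hν₀, hν₁, hslack⟩ := lpFeasible_iff.1 h
  rcases le_or_gt v u with hvu | huv
  · have hgain := mul_le_mul_of_nonneg_left
      (deviationGain_minOverlap_le (hmono j) hvu hu hzu hzv hz) hν₀
    have := hslack j u v hvu hu
    unfold constraintSlack at this ⊢
    linarith
  · have hρ : ρ ≤ 1 := h.le_one (by omega : 0 < n)
      (pos_of_monotoneOn_Icc (h₁ j) (hmono j) ⟨by omega, le_rfl⟩)
    exact constraintSlack_nonneg_of_lt (h₁ j) (hmono j) hρ hν₀ hν₁ huv hv hzu

theorem LPFeasible.constraintSlack_nonneg_of_mem_costClass (h : LPFeasible n b ρ ν)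
    (h₁ : ∀ j, 0 < b j 1) (hmono : ∀ j, MonotoneOn (b j) (Set.Icc 1 n)) {ℓ : ℕ → ℝ}
    (hℓ : ℓ ∈ costClass b) {u v z : ℕ} (hu : u ≤ n) (hv : v ≤ n) (hzu : z ≤ u) (hzv : z ≤ v)
    (hz : u + v ≤ n + z) : 0 ≤ constraintSlack ℓ ρ ν ((1 - ν) * ℓ 1) u v z := by
  obtain ⟨α, hα, rfl⟩ := hℓ
  rw [Finset.mul_sum, Finset.sum_congr rfl fun j _ => mul_left_comm (1 - ν) (α j) (b j 1),
    constraintSlack_sum_mul]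
  exact Finset.sum_nonneg fun j _ =>
    mul_nonneg (hα j) (h.constraintSlack_nonneg h₁ hmono j hu hv hzu hzv hz)

/-- The toll `T*` of the theorem, extended to all cost functions: on `∑ j, α j * b j` it is
`∑ j, α j * τ j` with `τ j = (1 / ν - 1) * b j 1`, since it is linear in `ℓ 1`. -/
noncomputable def optimalToll (ν : ℝ) (ℓ : ℕ → ℝ) : ℝ :=
  (1 / ν - 1) * ℓ 1

theorem LPFeasible.isSmooth (h : LPFeasible n b ρ ν) (h₁ : ∀ j, 0 < b j 1)
    (hmono : ∀ j, MonotoneOn (b j) (Set.Icc 1 n)) (hν : 0 < ν)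
    (G : CongestionGame n (costClass b)) :
    G.IsSmooth (congestionIndependent (optimalToll ν)) ρ ν := by
  intro a a'
  have hslack : ∀ e, 0 ≤ constraintSlack (G.cost e) ρ ν (ν * optimalToll ν (G.cost e))
      (G.load a e) (G.load a' e) (G.overlap a a' e) := fun e => by
    have hσ : ν * optimalToll ν (G.cost e) = (1 - ν) * G.cost e 1 := by
      unfold optimalToll
      field_simp
    rw [hσ]
    exact h.constraintSlack_nonneg_of_mem_costClass h₁ hmono (G.cost_mem e) (G.load_le a e)
      (G.load_le a' e) (Finset.card_le_card Finset.inter_subset_left)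
      (Finset.card_le_card Finset.inter_subset_right) (G.load_add_load_le a a' e)
  rw [G.systemCost_eq_sum_load, G.systemCost_eq_sum_load, G.sum_agentCost_sub_agentCost_update,
    Finset.mul_sum, Finset.mul_sum, ← Finset.sum_add_distrib]
  refine Finset.sum_le_sum fun e _ => ?_
  have := hslack e
  rw [constraintSlack_mul] at this
  unfold CongestionGame.tolledCost congestionIndependent
  linarith

theorem LPFeasible.coarsePoA_le (h : LPFeasible n b ρ ν) (h₁ : ∀ j, 0 < b j 1)
    (hmono : ∀ j, MonotoneOn (b j) (Set.Icc 1 n)) (hρ : 0 < ρ) (hν : 0 < ν) :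
    coarsePoA n (costClass b) (congestionIndependent (optimalToll ν)) ≤ ENNReal.ofReal (1 / ρ) :=
  coarsePoA_le_of_isSmooth (h.isSmooth h₁ hmono hν) hρ hν.le

end Smoothness

theorem exists_card_eq_card_inter_eq {α : Type*} [Fintype α] [DecidableEq α] {u v : ℕ}
    (hu : u ≤ Fintype.card α) (hv : v ≤ Fintype.card α) :
    ∃ s t : Finset α, #s = u ∧ #t = v ∧ #(s ∩ t) = u + v - Fintype.card α := by
  obtain ⟨s, -, hs⟩ := Finset.exists_subset_card_eq (s := (Finset.univ : Finset α)) hu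
  rcases le_total v #sᶜ with h | h
  · obtain ⟨t, hts, ht⟩ := Finset.exists_subset_card_eq h
    have hst : s ∩ t = ∅ := Finset.disjoint_iff_inter_eq_empty.1
      (Finset.disjoint_of_subset_right hts disjoint_compl_right)
    rw [Finset.card_compl] at h
    exact ⟨s, t, hs, ht, by rw [hst, Finset.card_empty]; omega⟩
  · obtain ⟨t, hst, -, ht⟩ := Finset.exists_subsuperset_card_eq (Finset.subset_univ sᶜ) h hv
    have hunion : s ∪ t = Finset.univ := Finset.eq_univ_iff_forall.2 fun x =>
      Finset.mem_union.2 <| or_iff_not_imp_left.2 fun hx => hst (Finset.mem_compl.2 hx)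
    have := Finset.card_union_add_card_inter s t
    rw [hunion, Finset.card_univ] at this
    exact ⟨s, t, hs, ht, by omega⟩

section CyclicGame

variable {n : ℕ} {K : Type} [Fintype K]

/-- The resources of agent `i` in a cyclic game, with one cycle `Fin n` of resources for each
`k : K`: on the `k`-th cycle she uses the pattern `S k` rotated by `i`. -/
def rotate (S : K → Finset (Fin n)) (i : Fin n) : Finset (K × Fin n) :=
  Finset.univ.filter fun e => e.2 - i ∈ S e.1

theorem mem_rotate {S : K → Finset (Fin n)} {i : Fin n} {e : K × Fin n} :
    e ∈ rotate S i ↔ e.2 - i ∈ S e.1 :=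
  Finset.mem_filter_univ e

variable [NeZero n]

theorem card_filter_mem_rotate [DecidableEq K] (S : K → Finset (Fin n)) (e : K × Fin n) :
    #{i | e ∈ rotate S i} = #(S e.1) :=
  Finset.card_equiv (Equiv.subLeft e.2) fun i => by simp [mem_rotate]

theorem sum_rotate (S : K → Finset (Fin n)) (i : Fin n) (g : K → ℝ) :
    ∑ e ∈ rotate S i, g e.1 = ∑ k, #(S k) * g k := by
  rw [rotate, Finset.sum_filter, Fintype.sum_prod_type]
  refine Finset.sum_congr rfl fun k _ =>
    (Equiv.sum_comp (Equiv.subRight i) fun x => if x ∈ S k then g k else 0).trans ?_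
  simp

theorem sum_rotate_sdiff [DecidableEq K] (S S' : K → Finset (Fin n)) (i : Fin n) (g : K → ℝ) :
    ∑ e ∈ rotate S i \ rotate S' i, g e.1 = ∑ k, #(S k \ S' k) * g k := by
  have hsdiff : rotate S i \ rotate S' i = rotate (fun k => S k \ S' k) i := by
    ext e
    simp only [Finset.mem_sdiff, mem_rotate]
  rw [hsdiff, sum_rotate]

variable [DecidableEq K] {L : Set (ℕ → ℝ)} (f : K → ℕ → ℝ) (hf : ∀ k, f k ∈ L)
  (S S' : K → Finset (Fin n))

/-- The game with `n` agents, each of whom chooses between the rotations of two patterns. By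
symmetry, when all agents choose the same pattern the load is constant on each cycle. -/
abbrev cyclicGame : CongestionGame n L where
  numAgents := n
  numAgents_le := le_rfl
  Resource := K × Fin n
  cost e := f e.1
  cost_mem e := hf e.1
  actions i := {rotate S i, rotate S' i}
  actions_nonempty i := ⟨rotate S i, Finset.mem_insert_self _ _⟩

variable {f hf S S'}

theorem load_cyclicGame {R : K → Finset (Fin n)} {a : (cyclicGame f hf S S').Allocation}
    (ha : ∀ i, (a i).1 = rotate R i) (e : K × Fin n) :
    (cyclicGame f hf S S').load a e = #(R e.1) := by
  refine (congrArg Finset.card (Finset.filter_congr fun i _ => ?_)).trans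
    (card_filter_mem_rotate R e)
  rw [ha i]

theorem systemCost_cyclicGame {R : K → Finset (Fin n)} {a : (cyclicGame f hf S S').Allocation}
    (ha : ∀ i, (a i).1 = rotate R i) :
    (cyclicGame f hf S S').systemCost a = n * ∑ k, f k #(R k) * #(R k) := by
  have hcost : ∀ i : Fin n, ∑ e ∈ (a i).1, f e.1 ((cyclicGame f hf S S').load a e)
      = ∑ k, f k #(R k) * #(R k) := fun i => by
    rw [ha i, Finset.sum_congr rfl fun e _ => congrArg (f e.1) (load_cyclicGame ha e),
      sum_rotate R i fun k => f k #(R k)]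
    exact Finset.sum_congr rfl fun k _ => mul_comm _ _
  exact (Finset.sum_congr rfl fun i _ => hcost i).trans (by simp)

theorem isPureNash_cyclicGame {T : LocalMechanism} {a : (cyclicGame f hf S S').Allocation}
    (ha : ∀ i, (a i).1 = rotate S i)
    (h : ∑ k, deviationGain (fun x => f k x + T (f k) x) #(S k) #(S' k) #(S k ∩ S' k) ≤ 0) :
    (cyclicGame f hf S S').IsPureNash T a := by
  intro i A
  rcases Finset.mem_insert.1 A.2 with hA | hA
  · obtain rfl : A = a i := Subtype.ext (hA.trans (ha i).symm)
    rw [Function.update_eq_self]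
  simp only [deviationGain_card, Finset.sum_sub_distrib] at h
  rw [← sum_rotate_sdiff S S' i fun k => f k #(S k) + T (f k) #(S k),
    ← sum_rotate_sdiff S' S i fun k => f k (#(S k) + 1) + T (f k) (#(S k) + 1)] at h
  rw [← sub_nonpos, CongestionGame.agentCost_sub_agentCost_update, ha, Finset.mem_singleton.1 hA,
    Finset.sum_congr rfl fun e _ =>
      congrArg ((cyclicGame f hf S S').tolledCost T e) (load_cyclicGame ha e),
    Finset.sum_congr rfl fun e _ =>
      congrArg (fun x => (cyclicGame f hf S S').tolledCost T e (x + 1)) (load_cyclicGame ha e)]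
  exact h

end CyclicGame
section LowerBound

variable {n : ℕ} {L : Set (ℕ → ℝ)} {T : LocalMechanism} {r : ℝ}

theorem CongestionGame.IsPureNash.mul_systemCost_le {G : CongestionGame n L} {a : G.Allocation}
    (ha : G.IsPureNash T a) (hr : 0 < r) (hPoA : pureNashPoA n L T ≤ ENNReal.ofReal (1 / r))
    {a' : G.Allocation} (ha' : 0 ≤ G.systemCost a') : r * G.systemCost a ≤ G.systemCost a' := by
  have hr' : 0 < 1 / r := one_div_pos.2 hr
  have hG : G.nashCost T ≤ ENNReal.ofReal (1 / r) * G.minCost :=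
    (ENNReal.div_le_iff_le_mul (.inr ENNReal.ofReal_ne_top)
      (.inr (ENNReal.ofReal_pos.2 hr').ne')).1 (iSup_le_iff.1 hPoA G)
  have hle : ENNReal.ofReal (G.systemCost a) ≤ ENNReal.ofReal (1 / r * G.systemCost a') :=
    calc ENNReal.ofReal (G.systemCost a) ≤ G.nashCost T :=
          le_iSup₂ (f := fun a (_ : G.IsPureNash T a) => ENNReal.ofReal (G.systemCost a)) a ha
      _ ≤ ENNReal.ofReal (1 / r) * G.minCost := hG
      _ ≤ ENNReal.ofReal (1 / r) * ENNReal.ofReal (G.systemCost a') := by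
          gcongr
          exact iInf_le _ a'
      _ = ENNReal.ofReal (1 / r * G.systemCost a') := (ENNReal.ofReal_mul hr'.le).symm
  rw [ENNReal.ofReal_le_ofReal_iff (mul_nonneg hr'.le ha'), one_div, ← div_eq_inv_mul] at hle
  exact (le_div_iff₀' hr).1 hle

theorem mul_sum_le_of_pureNashPoA_le [NeZero n] (hL : ∀ ℓ ∈ L, ∀ x ∈ Set.Icc 1 n, 0 ≤ ℓ x)
    (hr : 0 < r) (hPoA : pureNashPoA n L T ≤ ENNReal.ofReal (1 / r)) {K : Type} [Fintype K]
    {f : K → ℕ → ℝ} (hf : ∀ k, f k ∈ L) {u v : K → ℕ} (hu : ∀ k, u k ≤ n) (hv : ∀ k, v k ≤ n)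
    (hgain : ∑ k, deviationGain (fun x => f k x + T (f k) x) (u k) (v k) (u k + v k - n) ≤ 0) :
    r * ∑ k, f k (u k) * u k ≤ ∑ k, f k (v k) * v k := by
  classical
  have hpattern : ∀ k, ∃ s t : Finset (Fin n),
      #s = u k ∧ #t = v k ∧ #(s ∩ t) = u k + v k - n := fun k => by
    simpa only [Fintype.card_fin] using exists_card_eq_card_inter_eq (α := Fin n)
      ((hu k).trans_eq (Fintype.card_fin n).symm) ((hv k).trans_eq (Fintype.card_fin n).symm)
  choose S S' hS hS' hSS' using hpattern
  let G := cyclicGame f hf S S'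
  let a : G.Allocation := fun i => ⟨rotate S i, by simp [G]⟩
  let a' : G.Allocation := fun i => ⟨rotate S' i, by simp [G]⟩
  have hnash : G.IsPureNash T a :=
    isPureNash_cyclicGame (fun _ => rfl) (by simpa only [hS, hS', hSS'] using hgain)
  have hcost := hnash.mul_systemCost_le hr hPoA (G.systemCost_nonneg hL a')
  rw [systemCost_cyclicGame (R := S) fun _ => rfl, systemCost_cyclicGame (R := S') fun _ => rfl,
    mul_left_comm] at hcost
  simp only [hS, hS'] at hcost
  exact le_of_mul_le_mul_left hcost (Nat.cast_pos.2 (NeZero.pos n))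

variable {m : ℕ} {b : Fin m → ℕ → ℝ} {ρ ν : ℝ}

theorem basis_mem_costClass (j : Fin m) : b j ∈ costClass b :=
  ⟨Pi.single j 1, (Pi.single_nonneg.2 zero_le_one : (0 : Fin m → ℝ) ≤ Pi.single j 1),
    funext fun x => by simp [Pi.single_apply]⟩

theorem exists_constraintSlack_nonneg_of_pureNashPoA_le (hn : 0 < n)
    (h₀ : ∀ j, ∀ x ∈ Set.Icc 1 n, 0 ≤ b j x) {t : (ℕ → ℝ) → ℝ} (hr : 0 < r)
    (hPoA : pureNashPoA n (costClass b) (congestionIndependent t) ≤ ENNReal.ofReal (1 / r)) :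
    ∃ ν ≥ 0, ∀ (j : Fin m) (u v : ℕ), u ≤ n → v ≤ n →
      0 ≤ constraintSlack (b j) r ν (ν * t (b j)) u v (u + v - n) := by
  have : NeZero n := ⟨hn.ne'⟩
  let ι := Fin m × Fin (n + 1) × Fin (n + 1)
  let cost : ι → ℝ := fun k =>
    b k.1 k.2.2 * (k.2.2 : ℕ) - r * (b k.1 k.2.1 * (k.2.1 : ℕ))
  let gain : ι → ℝ := fun k =>
    deviationGain (fun x => b k.1 x + t (b k.1)) k.2.1 k.2.2 (k.2.1 + k.2.2 - n)
  have hpair : ∀ (k l : ι) (p q : ℕ), p * gain k + q * gain l ≤ 0 →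
      0 ≤ p * cost k + q * cost l := fun k l p q hpq => by
    let c : Fin p ⊕ Fin q → ι := Sum.elim (fun _ => k) fun _ => l
    have hsum := mul_sum_le_of_pureNashPoA_le
      (fun ℓ hℓ x hx => nonneg_of_mem_costClass (fun j => h₀ j x hx) hℓ) hr hPoA
      (f := fun i => b (c i).1) (fun i => basis_mem_costClass (c i).1)
      (u := fun i => (c i).2.1) (v := fun i => (c i).2.2)
      (fun i => Nat.le_of_lt_succ (c i).2.1.2) (fun i => Nat.le_of_lt_succ (c i).2.2.2)
      (by simpa [c, Fintype.sum_sum_type, gain, congestionIndependent] using hpq)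
    simp only [c, Fintype.sum_sum_type, Sum.elim_inl, Sum.elim_inr, Finset.sum_const,
      Finset.card_univ, Fintype.card_fin, nsmul_eq_mul] at hsum
    simp only [cost]
    linarith
  obtain ⟨ν, hν, hslack⟩ := exists_nonneg_forall_add_mul_nonneg hpair
  refine ⟨ν, hν, fun j u v hu hv => ?_⟩
  rw [constraintSlack_mul]
  exact hslack (j, ⟨u, Nat.lt_succ_of_le hu⟩, ⟨v, Nat.lt_succ_of_le hv⟩)

theorem lpFeasible_of_constraintSlack_nonneg (hn : 0 < n) (hm : 0 < m) (h₁ : ∀ j, 0 < b j 1)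
    {τ : Fin m → ℝ} (hτ : ∀ j, 0 ≤ τ j) (hν : 0 ≤ ν)
    (hslack : ∀ (j : Fin m) (u v : ℕ), u ≤ n → v ≤ n →
      0 ≤ constraintSlack (b j) ρ ν (ν * τ j) u v (u + v - n)) : LPFeasible n b ρ ν := by
  have hbound : ∀ j, ν * τ j ≤ (1 - ν) * b j 1 := fun j => by
    have hjoin := hslack j 0 1 n.zero_le hn
    simp only [constraintSlack, deviationGain, Nat.cast_zero, Nat.cast_one, zero_add,
      Nat.sub_eq_zero_of_le hn] at hjoin
    linarith
  refine lpFeasible_iff.2 ⟨hν, ?_, fun j u v hvu hu => ?_⟩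
  · let j : Fin m := ⟨0, hm⟩
    exact sub_nonneg.1 (nonneg_of_mul_nonneg_left
      ((mul_nonneg hν (hτ j)).trans (hbound j)) (h₁ j))
  · have hvu' : (0 : ℝ) ≤ u - v := sub_nonneg.2 (mod_cast hvu)
    exact (hslack j u v hu (hvu.trans hu)).trans
      (add_le_add_right (mul_le_mul_of_nonneg_right (hbound j) hvu') _)

theorem LPOptimal.ofReal_le_pureNashPoA (h : LPOptimal n b ρ ν) (hn : 0 < n) (hm : 0 < m)
    (h₁ : ∀ j, 0 < b j 1) (h₀ : ∀ j, ∀ x ∈ Set.Icc 1 n, 0 ≤ b j x) (hρ : 0 < ρ)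
    {t : (ℕ → ℝ) → ℝ} (ht : ∀ ℓ ∈ costClass b, 0 ≤ t ℓ) :
    ENNReal.ofReal (1 / ρ) ≤ pureNashPoA n (costClass b) (congestionIndependent t) := by
  by_contra! hlt
  obtain ⟨s, -, hPoA, hs⟩ := ENNReal.lt_iff_exists_real_btwn.1 hlt
  have hs₀ : 0 < s := ENNReal.ofReal_pos.1 (pos_of_gt hPoA)
  have hρs : ρ < 1 / s :=
    (lt_one_div hs₀ hρ).1 ((ENNReal.ofReal_lt_ofReal_iff (one_div_pos.2 hρ)).1 hs)
  obtain ⟨ν', hν', hslack⟩ := exists_constraintSlack_nonneg_of_pureNashPoA_le hn h₀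
    (one_div_pos.2 hs₀) (hPoA.le.trans_eq (by rw [one_div_one_div]))
  have hfeas := lpFeasible_of_constraintSlack_nonneg hn hm h₁
    (fun j => ht _ (basis_mem_costClass j)) hν' hslack
  exact hρs.not_ge (h.2 _ _ hfeas)

end LowerBound

theorem theorem3_general (n m : ℕ) (hn : 0 < n) (hm : 0 < m) (b : Fin m → ℕ → ℝ)
    (hpos : ∀ j x, 1 ≤ x → x ≤ n → 0 < b j x)
    (hmono : ∀ j x y, 1 ≤ x → x ≤ y → y ≤ n → b j x ≤ b j y) :
    (∃ ρ ν : ℝ, LPOptimal n b ρ ν ∧ 0 < ν) ∧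
    ((∃ j, b j 1 < b j n) → ∀ ρ ν : ℝ, LPOptimal n b ρ ν → 0 < ν) ∧
    ∀ ρ ν : ℝ, LPOptimal n b ρ ν → 0 < ν →
      0 < ρ ∧
      ∃ t : (ℕ → ℝ) → ℝ,
        (∀ α : Fin m → ℝ, (∀ j, 0 ≤ α j) →
          t (fun x => ∑ j, α j * b j x) = ∑ j, α j * ((1 / ν - 1) * b j 1)) ∧
        (∀ j, 0 ≤ (1 / ν - 1) * b j 1) ∧
        (∀ ℓ ∈ costClass b, 0 ≤ t ℓ) ∧
        pureNashPoA n (costClass b) (congestionIndependent t) = ENNReal.ofReal (1 / ρ) ∧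
        coarsePoA n (costClass b) (congestionIndependent t) = ENNReal.ofReal (1 / ρ) ∧
        ∀ t' : (ℕ → ℝ) → ℝ, (∀ ℓ ∈ costClass b, 0 ≤ t' ℓ) →
          pureNashPoA n (costClass b) (congestionIndependent t) ≤
            pureNashPoA n (costClass b) (congestionIndependent t') ∧
          coarsePoA n (costClass b) (congestionIndependent t) ≤
            coarsePoA n (costClass b) (congestionIndependent t') := by
  have h₁ : ∀ j, 0 < b j 1 := fun j => hpos j 1 le_rfl hn
  have hmono' : ∀ j, MonotoneOn (b j) (Set.Icc 1 n) := fun j x hx y hy hxy =>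
    hmono j x y hx.1 hxy hy.2
  refine ⟨exists_lpOptimal_pos hn hm h₁ hmono', fun hb ρ ν h => h.pos_snd hn h₁ hmono' hb,
    fun ρ ν h hν => ?_⟩
  have hρ : 0 < ρ := h.pos h₁ hmono'
  have hν₁ : 0 ≤ 1 / ν - 1 := sub_nonneg.2 ((one_le_div hν).2 h.1.2.1)
  have ht : ∀ ℓ ∈ costClass b, 0 ≤ optimalToll ν ℓ := fun ℓ hℓ =>
    mul_nonneg hν₁ (nonneg_of_mem_costClass (fun j => (h₁ j).le) hℓ)
  have hupper := h.1.coarsePoA_le h₁ hmono' hρ hν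
  have hlower : ∀ t : (ℕ → ℝ) → ℝ, (∀ ℓ ∈ costClass b, 0 ≤ t ℓ) →
      ENNReal.ofReal (1 / ρ) ≤ pureNashPoA n (costClass b) (congestionIndependent t) := fun _ =>
    h.ofReal_le_pureNashPoA hn hm h₁ (fun j x hx => (hpos j x hx.1 hx.2).le) hρ
  have hle := pureNashPoA_le_coarsePoA n (costClass b)
  have hpure := le_antisymm ((hle _).trans hupper) (hlower _ ht)
  have hcoarse := le_antisymm hupper ((hlower _ ht).trans (hle _))
  refine ⟨hρ, optimalToll ν, fun α _ => ?_, fun j => mul_nonneg hν₁ (h₁ j).le, ht, hpure, hcoarse,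
    fun t' ht' => ?_⟩
  · rw [optimalToll, Finset.mul_sum]
    exact Finset.sum_congr rfl fun j _ => mul_left_comm _ _ _
  · rw [hpure, hcoarse]
    exact ⟨hlower t' ht', (hlower t' ht').trans (hle _)⟩

theorem theorem3 (n m : ℕ) (hn : 0 < n) (hm : 0 < m) (b : Fin m → ℕ → ℝ)
    (hpos : ∀ j x, 1 ≤ x → x ≤ n → 0 < b j x)
    (hmono : ∀ j x y, 1 ≤ x → x ≤ y → y ≤ n → b j x ≤ b j y)
    (hconv : ∀ j, DiscreteConvex n (b j) ∨ DiscreteConvex n (fun x => b j x * x)) :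
    -- the linear program has a solution with `ν > 0`, and only such solutions unless all the
    -- basis functions are constant on `{1, …, n}`
    (∃ ρ ν : ℝ, LPOptimal n b ρ ν ∧ 0 < ν) ∧
    ((∃ j, b j 1 < b j n) → ∀ ρ ν : ℝ, LPOptimal n b ρ ν → 0 < ν) ∧
    -- every such solution yields an optimal mechanism
    ∀ ρ ν : ℝ, LPOptimal n b ρ ν → 0 < ν →
      0 < ρ ∧
      ∃ t : (ℕ → ℝ) → ℝ,
        (∀ α : Fin m → ℝ, (∀ j, 0 ≤ α j) →
          t (fun x => ∑ j, α j * b j x) = ∑ j, α j * ((1 / ν - 1) * b j 1)) ∧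
        (∀ j, 0 ≤ (1 / ν - 1) * b j 1) ∧
        (∀ ℓ ∈ costClass b, 0 ≤ t ℓ) ∧
        pureNashPoA n (costClass b) (congestionIndependent t) = ENNReal.ofReal (1 / ρ) ∧
        coarsePoA n (costClass b) (congestionIndependent t) = ENNReal.ofReal (1 / ρ) ∧
        ∀ t' : (ℕ → ℝ) → ℝ, (∀ ℓ ∈ costClass b, 0 ≤ t' ℓ) →
          pureNashPoA n (costClass b) (congestionIndependent t) ≤
            pureNashPoA n (costClass b) (congestionIndependent t') ∧
          coarsePoA n (costClass b) (congestionIndependent t) ≤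
            coarsePoA n (costClass b) (congestionIndependent t') :=
  theorem3_general n m hn hm b hpos hmono
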